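/- Let $\Sigma$ be a finite alphabet and let $\mathcal X\subseteq\Sigma^{\mathbf N}$ be a subshift, i.e. a subset that is closed in the product topology and invariant under the left shift. Let $L_{\mathcal X}$ be the set of all nonempty finite words that occur as a block in some element of $\mathcal X$, and let $S_{\mathcal X}=L_{\mathcal X}\cup\{0\}$ be the semigroup in which $\mu\nu$ is the concatenation if $\mu,\nu\neq0$ and the concatenation lies in $L_{\mathcal X}$, and $\mu\nu=0$ otherwise. For $\mu\in S_{\mathcal X}$ let $\theta_\mu$ be the partial bijection $x\mapsto\mu x$ of $L_{\mathcal X}$ with domain $\{x\in L_{\mathcal X}:\mu x\neq 0\}$, and let the inverse hull $\mathfrak H(S_{\mathcal X})$ be the inverse semigroup of partial bijections of $L_{\mathcal X}$ generated by all the $\theta_\mu$; its zero is the empty map. Let $\mathbf F$ be the free group on $\Sigma$, and regard words in $L_{\mathcal X}$ as elements of $\mathbf F$. Then $\mathfrak H(S_{\mathcal X})$ is strongly $0$-$E$-unitary. More precisely, there is a map $d:\mathfrak H(S_{\mathcal X})\to\mathbf F\cup\{0\}$ such that, for all $s,t\in\mathfrak H(S_{\mathcal X})$: (i) $d(s)=0$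 if and only if $s=0$; (ii) $d(s)=1$ if and only if $s$ is a nonzero idempotent; (iii) $d(st)=d(s)d(t)$ whenever $st\neq0$; (iv) $d(\theta_\mu)=\mu$ for every $\mu\in S_{\mathcal X}$; and moreover: (v) if every letter of $\Sigma$ occurs in some element of $\mathcal X$, then $\mathbf F$ is the universal group of $\mathfrak H(S_{\mathcal X})$ and $d$ is the universal partial homomorphism. That is, if $U$ is the group generated by symbols $\gamma_s$ ($s\in\mathfrak H(S_{\mathcal X})$, $s\neq0$) subject to the relations $\gamma_s\gamma_t=\gamma_{st}$ whenever $st\neq0$, then there is an isomorphism $U\to\mathbf F$ sending $\gamma_s$ to $d(s)$ for every $s\neq0$. (vi) Let $\widehat{\mathfrak E}(S_{\mathcal X})$ be the space, with the topology of pointwise convergence, of characters of the idempotent semilattice of $\mathfrak H(S_{\mathcal X})$, i.e. of nonzero multiplicative $\{0,1\}$-valued maps $\varphi$ with $\varphi(0)=0$. For $s\in\mathfrak H(S_{\mathcal X})$ let $\hat\theta_s$ be the partial homeomorphism from $\{\varphi:\varphi(s^{-1}s)=1\}$ onto $\{\varphi:\varphi(ss^{-1})=1\}$ given by $\hat\theta_s(\varphi)(e)=\varphi(s^{-1}es)$.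 Then the joins (unions of graphs) $$\alpha_g=\bigvee_{d(s)=g}\hat\theta_s\qquad(g\in\mathbf F)$$ are well-defined homeomorphisms $\alpha_g:X_{g^{-1}}\to X_g$ between open subsets of $\widehat{\mathfrak E}(S_{\mathcal X})$, and they form a partial action of $\mathbf F$ on $\widehat{\mathfrak E}(S_{\mathcal X})$. This partial action is semi-saturated, i.e. $\alpha_u\alpha_v=\alpha_{uv}$ whenever the concatenation of the reduced words of $u,v\in\mathbf F$ is reduced as written, and it is orthogonal, i.e. $X_a\cap X_b=\emptyset$ for all distinct $a,b\in\Sigma$. -/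

import Mathlib

/-! ## Inverse semigroups with zero -/

/-- An inverse semigroup with zero: every `s` has a generalized inverse `s⁻¹`, and idempotents
commute (so that the generalized inverse is unique). -/
class InverseSemigroupWithZero (S : Type*) extends SemigroupWithZero S, Inv S where
  mul_inv_mul' : ∀ s : S, s * s⁻¹ * s = s
  inv_mul_inv' : ∀ s : S, s⁻¹ * s * s⁻¹ = s⁻¹
  idem_comm' : ∀ e f : S, e * e = e → f * f = f → e * f = f * e

namespace InverseSemigroupWithZero

section PartialHoms

variable {S : Type*} [InverseSemigroupWithZero S] {G : Type*} [Group G]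

/-- `d : S → G ∪ {0}` takes the value `0` exactly at `0`. -/
def VanishesOnlyAtZero (d : S → WithZero G) : Prop :=
  ∀ s : S, d s = 0 ↔ s = 0

/-- `d : S → G ∪ {0}` is idempotent pure: `d s = 1` iff `s` is a nonzero idempotent. -/
def IsIdempotentPure (d : S → WithZero G) : Prop :=
  ∀ s : S, d s = 1 ↔ s ≠ 0 ∧ s * s = s

/-- `d : S → G ∪ {0}` is a partial homomorphism: it is multiplicative on nonzero products. -/
def IsPartialHom (d : S → WithZero G) : Prop :=
  ∀ s t : S, s * t ≠ 0 → d (s * t) = d s * d t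

end PartialHoms

/-- `S` is strongly `0`-`E`-unitary. -/
def IsStronglyZeroEUnitary.{u} (S : Type u) [InverseSemigroupWithZero S] : Prop :=
  ∃ (G : Type u) (_ : Group G) (d : S → WithZero G),
    VanishesOnlyAtZero d ∧ IsIdempotentPure d ∧ IsPartialHom d

/-- The relations `γ_s γ_t = γ_{st}`, for `s t ≠ 0`, between the generators `γ_s`, `s ≠ 0`. -/
def universalRels (S : Type*) [InverseSemigroupWithZero S] :
    Set (FreeGroup {s : S // s ≠ 0}) :=
  {r | ∃ (s t : {s : S // s ≠ 0}) (h : s.1 * t.1 ≠ 0),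
    r = FreeGroup.of s * FreeGroup.of t * (FreeGroup.of ⟨s.1 * t.1, h⟩)⁻¹}

/-- The universal group of `S`. -/
abbrev UniversalGroup (S : Type*) [InverseSemigroupWithZero S] : Type _ :=
  PresentedGroup (universalRels S)

open Classical in
/-- The canonical map `γ : S → UniversalGroup S ∪ {0}`. -/
noncomputable def universalMap (S : Type*) [InverseSemigroupWithZero S] (s : S) :
    WithZero (UniversalGroup S) :=
  if h : s ≠ 0 then ((PresentedGroup.of ⟨s, h⟩ : UniversalGroup S) : WithZero (UniversalGroup S))
  else 0

/-! ## The spectrum of the idempotent semilattice -/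

section Spectrum

variable (S : Type*) [InverseSemigroupWithZero S]

/-- The idempotent semilattice of `S`. -/
@[ext] structure Idem where
  /-- The underlying element. -/
  val : S
  idem : val * val = val

variable {S}

theorem idem_mul {e f : S} (he : e * e = e) (hf : f * f = f) : (e * f) * (e * f) = e * f := by
  rw [mul_assoc, ← mul_assoc f, ← idem_comm' e f he hf, mul_assoc, hf, ← mul_assoc, he]

instance : Mul (Idem S) := ⟨fun e f => ⟨e.val * f.val, idem_mul e.idem f.idem⟩⟩

instance : Zero (Idem S) := ⟨⟨0, mul_zero 0⟩⟩

variable (S) in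
/-- The spectrum of the idempotent semilattice of `S`: the set of characters, that is, of nonzero
`{0,1}`-valued multiplicative maps sending `0` to `0`. -/
@[ext] structure Spectrum where
  /-- The underlying map. -/
  toFun : Idem S → Bool
  exists_eq_true : ∃ e, toFun e = true
  map_zero : toFun 0 = false
  map_mul : ∀ e f, toFun (e * f) = (toFun e && toFun f)

/-- The topology of pointwise convergence. -/
instance : TopologicalSpace (Spectrum S) :=
  TopologicalSpace.induced Spectrum.toFun inferInstance

theorem idem_left {s t : S} (h : s * t * s = s) : (t * s) * (t * s) = t * s := by
  rw [mul_assoc, ← mul_assoc s, h]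

/-- If `s t s = s` and `t s t = t`, then `t e s` is idempotent for each idempotent `e`. -/
theorem idem_conj {s t : S} (h : s * t * s = s) (h' : t * s * t = t) (e : Idem S) :
    (t * e.val * s) * (t * e.val * s) = t * e.val * s := by
  have h1 : (s * t) * e.val = e.val * (s * t) := idem_comm' _ _ (idem_left h') e.idem
  calc (t * e.val * s) * (t * e.val * s) = t * e.val * ((s * t) * e.val) * s := by simp only [mul_assoc]
    _ = t * (e.val * e.val) * (s * t * s) := by rw [h1]; simp only [mul_assoc]
    _ = t * e.val * s := by rw [h, e.idem]

/-- The idempotent `t e s`, for mutually inverse `s` and `t`. -/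
def conj (s t : S) (h : s * t * s = s) (h' : t * s * t = t) (e : Idem S) : Idem S :=
  ⟨t * e.val * s, idem_conj h h' e⟩

theorem conj_mul (s t : S) (h : s * t * s = s) (h' : t * s * t = t) (e f : Idem S) :
    conj s t h h' (e * f) = conj s t h h' e * conj s t h h' f := by
  apply Idem.ext
  change t * (e.val * f.val) * s = (t * e.val * s) * (t * f.val * s)
  have h1 : (s * t) * f.val = f.val * (s * t) := idem_comm' _ _ (idem_left h') f.idem
  calc t * (e.val * f.val) * s = t * e.val * f.val * (s * t * s) := by rw [h]; simp only [mul_assoc]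
    _ = t * e.val * (f.val * (s * t)) * s := by simp only [mul_assoc]
    _ = (t * e.val * s) * (t * f.val * s) := by rw [← h1]; simp only [mul_assoc]

theorem conj_zero (s t : S) (h : s * t * s = s) (h' : t * s * t = t) :
    conj s t h h' 0 = 0 := by
  apply Idem.ext
  change t * 0 * s = 0
  rw [mul_zero, zero_mul]

/-- The idempotent `t s`. -/
def src (s t : S) (h : s * t * s = s) : Idem S := ⟨t * s, idem_left h⟩

theorem conj_src (s t : S) (h : s * t * s = s) (h' : t * s * t = t) :
    conj s t h h' (src t s h') = src s t h := by
  apply Idem.ext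
  change t * (s * t) * s = t * s
  rw [← mul_assoc, h']

theorem conj_conj (s t : S) (h : s * t * s = s) (h' : t * s * t = t) (e : Idem S) :
    conj s t h h' (conj t s h' h e) = src s t h * e * src s t h := by
  apply Idem.ext
  change t * (s * e.val * t) * s = t * s * e.val * (t * s)
  simp only [mul_assoc]

/-- The character `e ↦ φ (t e s)`, defined when `φ (t s) = 1`. -/
def push (s t : S) (h : s * t * s = s) (h' : t * s * t = t) (φ : Spectrum S)
    (hφ : φ.toFun (src s t h) = true) : Spectrum S :=
  ⟨fun e => φ.toFun (conj s t h h' e),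
    ⟨src t s h', (congrArg φ.toFun (conj_src s t h h')).trans hφ⟩,
    (congrArg φ.toFun (conj_zero s t h h')).trans φ.map_zero,
    fun e f => (congrArg φ.toFun (conj_mul s t h h' e f)).trans (φ.map_mul _ _)⟩

theorem push_src (s t : S) (h : s * t * s = s) (h' : t * s * t = t) (φ : Spectrum S)
    (hφ : φ.toFun (src s t h) = true) : (push s t h h' φ hφ).toFun (src t s h') = true := by
  change φ.toFun (conj s t h h' (src t s h')) = true
  rw [conj_src]; exact hφ

theorem push_push (s t : S) (h : s * t * s = s) (h' : t * s * t = t) (φ : Spectrum S)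
    (hφ : φ.toFun (src s t h) = true) :
    push t s h' h (push s t h h' φ hφ) (push_src s t h h' φ hφ) = φ := by
  apply Spectrum.ext
  funext e
  change φ.toFun (conj s t h h' (conj t s h' h e)) = φ.toFun e
  rw [conj_conj, φ.map_mul, φ.map_mul, hφ, Bool.and_true, Bool.true_and]

open Classical in
/-- The canonical action of `S` on the spectrum: `s` acts as the bijection from
`{φ | φ (s⁻¹ s) = 1}` to `{φ | φ (s s⁻¹) = 1}` sending `φ` to `e ↦ φ (s⁻¹ e s)`; its inverse is
`ψ ↦ (e ↦ ψ (s e s⁻¹))`. -/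
noncomputable def spectralAction (s : S) : Spectrum S ≃. Spectrum S where
  toFun φ := if hφ : φ.toFun (src s s⁻¹ (mul_inv_mul' s)) = true then
    some (push s s⁻¹ (mul_inv_mul' s) (inv_mul_inv' s) φ hφ) else none
  invFun ψ := if hψ : ψ.toFun (src s⁻¹ s (inv_mul_inv' s)) = true then
    some (push s⁻¹ s (inv_mul_inv' s) (mul_inv_mul' s) ψ hψ) else none
  inv φ ψ := by
    constructor
    · intro hx
      split_ifs at hx with hψ
      · obtain rfl := Option.mem_some_iff.1 hx
        rw [dif_pos (push_src _ _ _ _ ψ hψ), push_push]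
    · intro hx
      split_ifs at hx with hφ
      · obtain rfl := Option.mem_some_iff.1 hx
        rw [dif_pos (push_src _ _ _ _ φ hφ), push_push]

end Spectrum

end InverseSemigroupWithZero

/-! ## Topological partial actions -/

/-- A (topological) partial action of a discrete group `G` on a space `X`: a family of
homeomorphisms `α_g` between open subsets of `X`, with `α_1 = id`, `α_{g⁻¹} = α_g⁻¹`, and `α_{gh}`
extending `α_g ∘ α_h`. Here `f.trans g` is the partial map "first `f`, then `g`". -/
structure TopPartialAction (G : Type*) [Group G] (X : Type*) [TopologicalSpace X] where
  /-- The partial bijection by which `g` acts. -/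
  act : G → X ≃. X
  act_one : act 1 = PEquiv.refl X
  act_inv : ∀ g, act g⁻¹ = (act g).symm
  act_mul : ∀ g h, (act h).trans (act g) ≤ act (g * h)
  /-- Preimages of open sets are open; for the whole space this is openness of the domain. -/
  isOpen_preimage : ∀ g (V : Set X), IsOpen V → IsOpen {x | ∃ y ∈ V, y ∈ act g x}

namespace TopPartialAction

variable {G : Type*} [Group G] {X : Type*} [TopologicalSpace X]

/-- The range `X_g` of `α_g`. -/
def range (α : TopPartialAction G X) (g : G) : Set X := {y | ∃ x, y ∈ α.act g x}

/-- A partial action of a free group is semi-saturated if `α_u α_v = α_{uv}` whenever the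
concatenation of the reduced words of `u` and `v` is reduced. -/
def IsSemiSaturated {A : Type*} [DecidableEq A] (α : TopPartialAction (FreeGroup A) X) : Prop :=
  ∀ u v : FreeGroup A, FreeGroup.IsReduced (u.toWord ++ v.toWord) →
    (α.act v).trans (α.act u) = α.act (u * v)

/-- A partial action of a free group is orthogonal if the ranges of distinct generators are
disjoint. -/
def IsOrthogonal {A : Type*} (α : TopPartialAction (FreeGroup A) X) : Prop :=
  ∀ a b : A, a ≠ b → Disjoint (α.range (FreeGroup.of a)) (α.range (FreeGroup.of b))

open InverseSemigroupWithZero in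
/-- `α_g` is the join (union of graphs) of the canonical partial homeomorphisms by which the
elements `s` with `d s = g` act on the spectrum. -/
def IsInducedBy {S : Type*} [InverseSemigroupWithZero S]
    (α : TopPartialAction G (Spectrum S)) (d : S → WithZero G) : Prop :=
  ∀ (g : G) (φ ψ : Spectrum S),
    ψ ∈ α.act g φ ↔ ∃ s : S, d s = (g : WithZero G) ∧ ψ ∈ spectralAction s φ

end TopPartialAction

/-! ## The inverse hull of a `0`-left-cancellative semigroup -/

/-- `S` is `0`-left-cancellative: `s x = s y ≠ 0` implies `x = y`. -/
class ZeroLeftCancellative (S : Type*) [SemigroupWithZero S] : Prop where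
  cancel : ∀ s x y : S, s * x = s * y → s * x ≠ 0 → x = y

section Hull

variable {S : Type*} [SemigroupWithZero S] [ZeroLeftCancellative S]

open Classical in
/-- The regular representation on the nonzero elements: `θ_s` is the bijection `x ↦ s x`
from `F_s = {x | s x ≠ 0}` onto `E_s = {s x | s x ≠ 0}`. -/
noncomputable def regularRep (s : S) : {x : S // x ≠ 0} ≃. {x : S // x ≠ 0} where
  toFun x := if h : s * x.1 ≠ 0 then some ⟨s * x.1, h⟩ else none
  invFun y := if h : ∃ x : {x : S // x ≠ 0}, s * x.1 = y.1 then some h.choose else none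
  inv x y := by
    constructor
    · intro hx
      split_ifs at hx with h
      · have h1 := h.choose_spec
        rw [Option.mem_some_iff.1 hx] at h1
        have h2 : s * x.1 ≠ 0 := by rw [h1]; exact y.2
        rw [dif_pos h2]
        exact Option.mem_some_iff.2 (Subtype.ext h1)
    · intro hy
      split_ifs at hy with h
      · have h1 : s * x.1 = y.1 := congrArg Subtype.val (Option.mem_some_iff.1 hy)
        have h2 : ∃ x : {x : S // x ≠ 0}, s * x.1 = y.1 := ⟨x, h1⟩
        rw [dif_pos h2]
        refine Option.mem_some_iff.2 (Subtype.ext ?_)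
        refine ZeroLeftCancellative.cancel s _ _ (h2.choose_spec.trans h1.symm) ?_
        rw [h2.choose_spec]; exact y.2

variable (S) in
/-- Membership in the inverse subsemigroup generated by the `θ_s` inside the symmetric inverse
semigroup of partial bijections of the nonzero elements of `S`. -/
inductive MemHull : ({x : S // x ≠ 0} ≃. {x : S // x ≠ 0}) → Prop
  | gen (s : S) : MemHull (regularRep s)
  | comp (f g : {x : S // x ≠ 0} ≃. {x : S // x ≠ 0}) :
      MemHull f → MemHull g → MemHull (g.trans f)
  | inv (f : {x : S // x ≠ 0} ≃. {x : S // x ≠ 0}) : MemHull f → MemHull f.symm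

variable (S) in
/-- The inverse hull of `S`. -/
@[ext] structure InverseHull where
  /-- The underlying partial bijection. -/
  val : {x : S // x ≠ 0} ≃. {x : S // x ≠ 0}
  mem : MemHull S val

theorem regularRep_zero : regularRep (0 : S) = ⊥ := by
  apply PEquiv.ext
  intro x
  simp [regularRep]

theorem PEquiv.trans_symm_trans_self {X : Type*} (f : X ≃. X) :
    (f.trans f.symm).trans f = f := by
  rw [PEquiv.self_trans_symm]
  apply PEquiv.ext
  intro x
  apply Option.ext
  intro y
  constructor
  · intro h
    obtain ⟨z, hz, hy⟩ := (PEquiv.mem_trans _ _ _ _).1 h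
    obtain ⟨rfl, -⟩ := PEquiv.mem_ofSet_iff.1 hz
    exact hy
  · intro h
    refine (PEquiv.mem_trans _ _ _ _).2 ⟨x, ?_, h⟩
    refine PEquiv.mem_ofSet_iff.2 ⟨rfl, ?_⟩
    exact Option.isSome_iff_exists.2 ⟨y, h⟩

theorem PEquiv.eq_of_idem {X : Type*} {f : X ≃. X} (hf : f.trans f = f) {x y : X}
    (h : y ∈ f x) : x = y := by
  have h1 := h
  rw [← hf] at h1
  obtain ⟨z, hz, hy⟩ := (PEquiv.mem_trans _ _ _ _).1 h1
  obtain rfl : z = y := Option.mem_unique hz h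
  exact f.inj h hy

theorem PEquiv.trans_comm_of_idem {X : Type*} {f g : X ≃. X} (hf : f.trans f = f)
    (hg : g.trans g = g) : f.trans g = g.trans f := by
  have key : ∀ {f g : X ≃. X}, f.trans f = f → g.trans g = g → ∀ x y,
      y ∈ f.trans g x → y ∈ g.trans f x := by
    intro f g hf hg x y h
    obtain ⟨z, hz, hy⟩ := (PEquiv.mem_trans _ _ _ _).1 h
    obtain rfl := PEquiv.eq_of_idem hf hz
    obtain rfl := PEquiv.eq_of_idem hg hy
    exact (PEquiv.mem_trans _ _ _ _).2 ⟨x, hy, hz⟩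
  apply PEquiv.ext
  intro x
  apply Option.ext
  intro y
  exact ⟨key hf hg x y, key hg hf x y⟩

/-- The product in the inverse hull is composition: `(f * g) x = f (g x)`. -/
instance : InverseSemigroupWithZero (InverseHull S) where
  mul f g := ⟨g.val.trans f.val, MemHull.comp _ _ f.mem g.mem⟩
  mul_assoc f g h := InverseHull.ext (PEquiv.trans_assoc h.val g.val f.val).symm
  zero := ⟨⊥, by rw [← regularRep_zero]; exact MemHull.gen 0⟩
  zero_mul f := InverseHull.ext (PEquiv.trans_bot f.val)
  mul_zero f := InverseHull.ext (PEquiv.bot_trans f.val)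
  inv f := ⟨f.val.symm, MemHull.inv _ f.mem⟩
  mul_inv_mul' f := InverseHull.ext <| by
    change f.val.trans (f.val.symm.trans f.val) = f.val
    rw [← PEquiv.trans_assoc]; exact PEquiv.trans_symm_trans_self f.val
  inv_mul_inv' f := InverseHull.ext <| by
    change f.val.symm.trans (f.val.trans f.val.symm) = f.val.symm
    rw [← PEquiv.trans_assoc]; exact PEquiv.trans_symm_trans_self f.val.symm
  idem_comm' e f he hf := InverseHull.ext <|
    PEquiv.trans_comm_of_idem (congrArg InverseHull.val hf) (congrArg InverseHull.val he)

/-- The canonical image `θ_s` of `s` in the inverse hull. -/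
noncomputable def hullTheta (s : S) : InverseHull S := ⟨regularRep s, MemHull.gen s⟩

end Hull

/-! ## Subshift semigroups -/

open SymbolicDynamics.FullShift

section Subshift

variable {A : Type*} [TopologicalSpace A]

/-- The language of a (one-sided) subshift: the nonempty finite words occurring as a block
`x_k x_{k+1} ⋯ x_{k+n-1}` of some infinite word `x` in the subshift. -/
def subshiftLanguage (X : Subshift A ℕ) : Set (List A) :=
  {w | w ≠ [] ∧ ∃ x ∈ X.carrier, ∃ k : ℕ, ∀ (i : ℕ) (hi : i < w.length), w[i] = x (k + i)}

theorem subshiftLanguage_left {X : Subshift A ℕ} {u v : List A} (hu : u ≠ [])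
    (h : u ++ v ∈ subshiftLanguage X) : u ∈ subshiftLanguage X := by
  obtain ⟨-, x, hx, k, hk⟩ := h
  refine ⟨hu, x, hx, k, fun i hi => ?_⟩
  have h1 := hk i (by rw [List.length_append]; omega)
  rwa [List.getElem_append_left hi] at h1

theorem subshiftLanguage_right {X : Subshift A ℕ} {u v : List A} (hv : v ≠ [])
    (h : u ++ v ∈ subshiftLanguage X) : v ∈ subshiftLanguage X := by
  obtain ⟨-, x, hx, k, hk⟩ := h
  refine ⟨hv, x, hx, k + u.length, fun i hi => ?_⟩
  have h1 := hk (u.length + i) (by rw [List.length_append]; omega)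
  rw [List.getElem_append_right (by omega)] at h1
  simpa [add_assoc] using h1

/-- The subshift semigroup: the language together with a zero element. -/
inductive SubshiftSemigroup (X : Subshift A ℕ) : Type _
  | zero : SubshiftSemigroup X
  | word (w : List A) (hw : w ∈ subshiftLanguage X) : SubshiftSemigroup X

namespace SubshiftSemigroup

variable {X : Subshift A ℕ}

open Classical in
/-- The element of the subshift semigroup given by a word, `0` if the word is not in the
language. -/
noncomputable def ofWord (X : Subshift A ℕ) (w : List A) : SubshiftSemigroup X :=
  if h : w ∈ subshiftLanguage X then word w h else zero

/-- Concatenation if the result is in the language, and `0` otherwise. -/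
noncomputable def mul' : SubshiftSemigroup X → SubshiftSemigroup X → SubshiftSemigroup X
  | word u _, word v _ => ofWord X (u ++ v)
  | _, _ => zero

theorem ofWord_pos {w : List A} (h : w ∈ subshiftLanguage X) : ofWord X w = word w h :=
  dif_pos h

theorem ofWord_neg {w : List A} (h : w ∉ subshiftLanguage X) : ofWord X w = zero :=
  dif_neg h

theorem mul'_zero (u : SubshiftSemigroup X) : mul' u zero = zero := by
  cases u <;> rfl

theorem zero_mul' (u : SubshiftSemigroup X) : mul' zero u = zero := by
  cases u <;> rfl

theorem mul'_ofWord {u : List A} (hu : u ∈ subshiftLanguage X) {v : List A} (hv : v ≠ []) :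
    mul' (word u hu) (ofWord X v) = ofWord X (u ++ v) := by
  by_cases h : v ∈ subshiftLanguage X
  · rw [ofWord_pos h]; rfl
  · rw [ofWord_neg h, mul'_zero, ofWord_neg fun h' => h (subshiftLanguage_right hv h')]

theorem ofWord_mul' {u v : List A} (hu : u ≠ []) (hv : v ∈ subshiftLanguage X) :
    mul' (ofWord X u) (word v hv) = ofWord X (u ++ v) := by
  by_cases h : u ∈ subshiftLanguage X
  · rw [ofWord_pos h]; rfl
  · rw [ofWord_neg h, zero_mul', ofWord_neg fun h' => h (subshiftLanguage_left hu h')]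

noncomputable instance : SemigroupWithZero (SubshiftSemigroup X) where
  mul := mul'
  zero := zero
  zero_mul := zero_mul'
  mul_zero := mul'_zero
  mul_assoc a b c := by
    change mul' (mul' a b) c = mul' a (mul' b c)
    rcases a with _ | ⟨u, hu⟩
    · rw [zero_mul', zero_mul', zero_mul']
    rcases b with _ | ⟨v, hv⟩
    · rw [mul'_zero, zero_mul', mul'_zero]
    rcases c with _ | ⟨w, hw⟩
    · rw [mul'_zero, mul'_zero, mul'_zero]
    change mul' (ofWord X (u ++ v)) (word w hw) = mul' (word u hu) (ofWord X (v ++ w))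
    rw [ofWord_mul' (by simp [hu.1]), mul'_ofWord hu (by simp [hv.1]), List.append_assoc]

instance : ZeroLeftCancellative (SubshiftSemigroup X) where
  cancel a b c h h0 := by
    change mul' a b = mul' a c at h
    change mul' a b ≠ zero at h0
    rcases a with _ | ⟨u, hu⟩
    · exact absurd (zero_mul' b) h0
    rcases b with _ | ⟨v, hv⟩
    · exact absurd (mul'_zero _) h0
    rcases c with _ | ⟨w, hw⟩
    · exact absurd (h.trans (mul'_zero _)) h0
    change ofWord X (u ++ v) = ofWord X (u ++ w) at h
    change ofWord X (u ++ v) ≠ zero at h0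
    have hv' : u ++ v ∈ subshiftLanguage X := by
      by_contra hn
      exact h0 (ofWord_neg hn)
    have hw' : u ++ w ∈ subshiftLanguage X := by
      by_contra hn
      exact h0 (h.trans (ofWord_neg hn))
    rw [ofWord_pos hv', ofWord_pos hw'] at h
    have h1 : u ++ v = u ++ w := by injection h
    obtain rfl := List.append_cancel_left h1
    rfl

/-- The canonical map into the free group on the alphabet with a zero adjoined: a word is sent to
the product of its letters, and `0` to `0`. -/
def toFreeGroupWithZero : SubshiftSemigroup X → WithZero (FreeGroup A)
  | word w _ => (((w.map FreeGroup.of).prod : FreeGroup A) : WithZero (FreeGroup A))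
  | zero => 0

end SubshiftSemigroup

end Subshift

/-! Words embed injectively into `FreeGroup A`. Prefixing a word, deleting a prefix, and all
composites of these are restrictions of left translations of the free group. A nonempty element of
the inverse hull therefore translates by a unique group element, its `degree`. Degree `1` means
being a restriction of the identity, that is, an idempotent (`memHull_translation`,
`isIdempotentPure_degree`). Since the `θ_μ` generate the hull and are products of letters, every
partial homomorphism is determined by its values on letters, which makes the free group universal.

The partial action exists for every idempotent pure partial homomorphism. If `d s = d t` and the
domains meet, then `s t⁻¹` has degree `1`, so it is idempotent and `s`, `t` agree where both are
defined (`mul_src_mul_src_eq`). Hence the join over a fixed degree is again a partial bijection.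

Semi-saturation becomes a factorization problem: split `r` of degree `uv`, reduced as written, into
factors of degrees `u` and `v` (`exists_factorization`). Hull elements also preserve last letters.
So if `r` sends `x` to `y`, then `y = m w` and `x = n w` with `w` nonempty and `m n⁻¹` reduced, and
`m n⁻¹ = uv`. The cut falls inside `m` or inside `n⁻¹`: either `u` is a prefix of `y` or `v⁻¹` is a
prefix of `x`, with a nonempty remainder. That prefix is split off by its `θ`. Orthogonality holds
because the range of an element of degree `a` consists of words beginning with `a`. -/

theorem PEquiv.ext_mem {X Y : Type*} {f g : X ≃. Y} (h : ∀ x y, y ∈ f x ↔ y ∈ g x) : f = g :=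
  PEquiv.ext fun x => Option.ext fun y => h x y

namespace InverseSemigroupWithZero

/-! ### Uniqueness and calculus of inverses. -/

section Inverses

variable {S : Type*} [InverseSemigroupWithZero S]

/-- The usual uniqueness argument: commuting `b a` past `a⁻¹ a`, and then `a b` past `a a⁻¹`,
replaces `b` by `a⁻¹` one side at a time. -/
theorem eq_inv_of_mul {a b : S} (h : a * b * a = a) (h' : b * a * b = b) : b = a⁻¹ := by
  have k := mul_inv_mul' a
  have k' := inv_mul_inv' a
  have h1 : (b * a) * (a⁻¹ * a) = (a⁻¹ * a) * (b * a) := idem_comm' _ _ (idem_left h) (idem_left k)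
  have h2 : (a * b) * (a * a⁻¹) = (a * a⁻¹) * (a * b) :=
    idem_comm' _ _ (idem_left h') (idem_left k')
  calc b = b * (a * a⁻¹ * a) * b := by rw [k, h']
    _ = (b * a) * (a⁻¹ * a) * b := by simp only [mul_assoc]
    _ = a⁻¹ * (a * b * a) * b := by rw [h1]; simp only [mul_assoc]
    _ = a⁻¹ * a * b := by rw [h]
    _ = a⁻¹ * (a * a⁻¹ * a) * b := by rw [k]
    _ = a⁻¹ * ((a * a⁻¹) * (a * b)) := by simp only [mul_assoc]
    _ = a⁻¹ * (a * b * a) * a⁻¹ := by rw [← h2]; simp only [mul_assoc]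
    _ = a⁻¹ := by rw [h, k']

theorem inv_inv' (a : S) : a⁻¹⁻¹ = a := (eq_inv_of_mul (inv_mul_inv' a) (mul_inv_mul' a)).symm

theorem inv_eq_self_of_idem {e : S} (h : e * e = e) : e⁻¹ = e :=
  (eq_inv_of_mul (by rw [h, h]) (by rw [h, h])).symm

theorem inv_mul_self_idem (a : S) : (a⁻¹ * a) * (a⁻¹ * a) = a⁻¹ * a := idem_left (mul_inv_mul' a)

theorem mul_inv_self_idem (a : S) : (a * a⁻¹) * (a * a⁻¹) = a * a⁻¹ := idem_left (inv_mul_inv' a)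

theorem mul_inv_rev' (a b : S) : (a * b)⁻¹ = b⁻¹ * a⁻¹ := by
  have hc : (b * b⁻¹) * (a⁻¹ * a) = (a⁻¹ * a) * (b * b⁻¹) :=
    idem_comm' _ _ (mul_inv_self_idem b) (inv_mul_self_idem a)
  refine (eq_inv_of_mul ?_ ?_).symm
  · calc a * b * (b⁻¹ * a⁻¹) * (a * b) = a * ((b * b⁻¹) * (a⁻¹ * a)) * b := by
          simp only [mul_assoc]
      _ = (a * a⁻¹ * a) * (b * b⁻¹ * b) := by rw [hc]; simp only [mul_assoc]
      _ = a * b := by rw [mul_inv_mul', mul_inv_mul']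
  · calc b⁻¹ * a⁻¹ * (a * b) * (b⁻¹ * a⁻¹) = b⁻¹ * ((a⁻¹ * a) * (b * b⁻¹)) * a⁻¹ := by
          simp only [mul_assoc]
      _ = (b⁻¹ * b * b⁻¹) * (a⁻¹ * a * a⁻¹) := by rw [← hc]; simp only [mul_assoc]
      _ = b⁻¹ * a⁻¹ := by rw [inv_mul_inv', inv_mul_inv']

theorem inv_mul_self_ne_zero {a : S} (h : a ≠ 0) : a⁻¹ * a ≠ 0 := fun h' => h <| by
  rw [← mul_inv_mul' a, mul_assoc, h', mul_zero]

theorem mul_inv_self_ne_zero {a : S} (h : a ≠ 0) : a * a⁻¹ ≠ 0 := fun h' => h <| by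
  rw [← mul_inv_mul' a, h', zero_mul]

theorem conj_idem (s : S) {e : S} (he : e * e = e) : (s⁻¹ * e * s) * (s⁻¹ * e * s) = s⁻¹ * e * s :=
  idem_conj (mul_inv_mul' s) (inv_mul_inv' s) ⟨e, he⟩

end Inverses

/-! ### Idempotent pure partial homomorphisms. -/

section Degree

variable {S : Type*} [InverseSemigroupWithZero S] {G : Type*} [Group G] {d : S → WithZero G}

/-- For `s ≠ 0` the value at `s⁻¹ s` is nonzero and equal to its own square, hence `1`. -/
theorem map_inv_of_isPartialHom (h0 : VanishesOnlyAtZero d) (hm : IsPartialHom d) (s : S) :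
    d s⁻¹ = (d s)⁻¹ := by
  by_cases hs : s = 0
  · subst hs
    rw [inv_eq_self_of_idem (mul_zero 0), (h0 0).2 rfl, inv_zero]
  have hs' : d s ≠ 0 := fun h => hs ((h0 s).1 h)
  have h1 := hm _ _ (inv_mul_self_ne_zero hs)
  have h2 := hm (s⁻¹ * s) (s⁻¹ * s) (by rw [inv_mul_self_idem]; exact inv_mul_self_ne_zero hs)
  rw [inv_mul_self_idem] at h2
  have h3 : d (s⁻¹ * s) = 1 := by
    refine mul_left_cancel₀ (fun h => inv_mul_self_ne_zero hs ((h0 _).1 h)) ?_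
    rw [← h2, mul_one]
  rw [h3] at h1
  exact eq_inv_of_mul_eq_one_left h1.symm

/-- Elements of equal degree agree on the intersection of their domains. -/
theorem mul_src_mul_src_eq (h0 : VanishesOnlyAtZero d) (hi : IsIdempotentPure d)
    (hm : IsPartialHom d) {s t : S} (hst : d s = d t) (h : (s⁻¹ * s) * (t⁻¹ * t) ≠ 0) :
    s * (t⁻¹ * t) = t * (s⁻¹ * s) := by
  have hne : s * t⁻¹ ≠ 0 := fun h' => h <| by
    rw [mul_assoc, ← mul_assoc s, h', zero_mul, mul_zero]
  have hs : s ≠ 0 := fun h' => hne (by rw [h', zero_mul])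
  -- Purity makes `s t⁻¹` idempotent, hence equal to its own inverse `t s⁻¹`.
  have hd : d (s * t⁻¹) = 1 := by
    rw [hm _ _ hne, map_inv_of_isPartialHom h0 hm, ← hst, mul_inv_cancel₀]
    exact fun h' => hs ((h0 s).1 h')
  have he := ((hi _).1 hd).2
  have he' : s * t⁻¹ = t * s⁻¹ := by
    rw [← inv_eq_self_of_idem he, mul_inv_rev', inv_inv']
  have hc : (s⁻¹ * s) * (t⁻¹ * t) = (t⁻¹ * t) * (s⁻¹ * s) :=
    idem_comm' _ _ (inv_mul_self_idem s) (inv_mul_self_idem t)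
  calc s * (t⁻¹ * t) = s * s⁻¹ * s * (t⁻¹ * t) := by rw [mul_inv_mul']
    _ = s * ((s⁻¹ * s) * (t⁻¹ * t)) := by simp only [mul_assoc]
    _ = (s * t⁻¹) * (t * s⁻¹) * s := by rw [hc]; simp only [mul_assoc]
    _ = t * (s⁻¹ * s) := by rw [← he', he, he', mul_assoc]

end Degree

/-! ### Characters as filters, and the action on the spectrum. -/

section Filters

variable {S : Type*} [InverseSemigroupWithZero S]

/-- The idempotents on which a character takes the value `1`. -/
def Spectrum.filter (φ : Spectrum S) : Set S := {e | ∃ h : e * e = e, φ.toFun ⟨e, h⟩ = true}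

theorem Spectrum.mem_filter {φ : Spectrum S} {e : S} (h : e * e = e) :
    e ∈ φ.filter ↔ φ.toFun ⟨e, h⟩ = true := ⟨fun ⟨_, h'⟩ => h', fun h' => ⟨h, h'⟩⟩

theorem Spectrum.zero_notMem_filter (φ : Spectrum S) : (0 : S) ∉ φ.filter := by
  rintro ⟨_, h⟩
  exact Bool.false_ne_true (φ.map_zero.symm.trans h)

theorem Spectrum.mul_mem_filter {φ : Spectrum S} {e f : S} (he : e * e = e) (hf : f * f = f) :
    e * f ∈ φ.filter ↔ e ∈ φ.filter ∧ f ∈ φ.filter := by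
  rw [mem_filter (idem_mul he hf), mem_filter he, mem_filter hf]
  have h : φ.toFun ⟨e * f, idem_mul he hf⟩ = _ := φ.map_mul ⟨e, he⟩ ⟨f, hf⟩
  rw [h, Bool.and_eq_true]

theorem Spectrum.ext_filter {φ ψ : Spectrum S}
    (h : ∀ e, e * e = e → (e ∈ φ.filter ↔ e ∈ ψ.filter)) : φ = ψ := by
  apply Spectrum.ext
  funext e
  rw [Bool.eq_iff_iff, ← mem_filter e.idem, ← mem_filter e.idem]
  exact h e.val e.idem

/-- Working with filters of elements of `S` removes the proof terms carried by `push` and `conj`;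
the algebra of the action is computed from this description. -/
theorem mem_spectralAction {s : S} {φ ψ : Spectrum S} :
    ψ ∈ spectralAction s φ ↔ s⁻¹ * s ∈ φ.filter ∧
      ∀ e, e * e = e → (e ∈ ψ.filter ↔ s⁻¹ * e * s ∈ φ.filter) := by
  have hd : s⁻¹ * s ∈ φ.filter ↔ φ.toFun (src s s⁻¹ (mul_inv_mul' s)) = true :=
    Spectrum.mem_filter (inv_mul_self_idem s)
  rw [hd]
  change ψ ∈ dite _ _ _ ↔ _
  have hp : ∀ h, ∀ e, e * e = e →
      (e ∈ (push s s⁻¹ (mul_inv_mul' s) (inv_mul_inv' s) φ h).filter ↔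
        s⁻¹ * e * s ∈ φ.filter) := fun h e he => by
    rw [Spectrum.mem_filter he, Spectrum.mem_filter (conj_idem s he)]
    rfl
  constructor
  · intro h
    split_ifs at h with h1
    · obtain rfl := Option.mem_some_iff.1 h
      exact ⟨h1, hp h1⟩
    · simp at h
  · rintro ⟨h1, h2⟩
    rw [dif_pos h1, Option.mem_some_iff]
    exact Spectrum.ext_filter fun e he => (hp h1 e he).trans (h2 e he).symm

theorem exists_mem_spectralAction {s : S} {φ : Spectrum S} (h : s⁻¹ * s ∈ φ.filter) :
    ∃ ψ, ψ ∈ spectralAction s φ :=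
  ⟨_, dif_pos ((Spectrum.mem_filter (inv_mul_self_idem s)).1 h)⟩

theorem spectralAction_inv (s : S) : spectralAction s⁻¹ = (spectralAction s).symm := by
  have key : ∀ (s t : S) (h : s * t * s = s) (h' : t * s * t = t), s⁻¹ = t →
      ∀ φ ψ, ψ ∈ spectralAction s⁻¹ φ → φ ∈ spectralAction s ψ := by
    intro s t h h' ht φ ψ hψ
    rw [mem_spectralAction, inv_inv'] at hψ
    have hs : s⁻¹ * s ∈ ψ.filter := by
      rw [hψ.2 _ (inv_mul_self_idem s), ← mul_assoc, mul_inv_mul']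
      exact hψ.1
    refine mem_spectralAction.2 ⟨hs, fun e he => ?_⟩
    -- Conjugating forth and back only cuts `e` down by `s s⁻¹`, which already lies in the filter of
    -- `φ`.
    have h1 : s * (s⁻¹ * e * s) * s⁻¹ = (s * s⁻¹) * e * (s * s⁻¹) := by simp only [mul_assoc]
    rw [hψ.2 _ (conj_idem s he), h1,
      Spectrum.mul_mem_filter (idem_mul (mul_inv_self_idem s) he) (mul_inv_self_idem s),
      Spectrum.mul_mem_filter (mul_inv_self_idem s) he]
    exact ⟨fun h => ⟨⟨hψ.1, h⟩, hψ.1⟩, fun h => h.1.2⟩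
  refine PEquiv.ext_mem fun φ ψ => ?_
  rw [PEquiv.mem_iff_mem]
  constructor
  · exact key s s⁻¹ (mul_inv_mul' s) (inv_mul_inv' s) rfl φ ψ
  · intro h
    refine key s⁻¹ s (inv_mul_inv' s) (mul_inv_mul' s) (inv_inv' s) ψ φ ?_
    rwa [inv_inv']

theorem spectralAction_mul (s t : S) :
    (spectralAction t).trans (spectralAction s) = spectralAction (s * t) := by
  have hsrc : (s * t)⁻¹ * (s * t) = t⁻¹ * (s⁻¹ * s) * t := by
    rw [mul_inv_rev']; simp only [mul_assoc]
  have hconj : ∀ e, (s * t)⁻¹ * e * (s * t) = t⁻¹ * (s⁻¹ * e * s) * t := fun e => by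
    rw [mul_inv_rev']; simp only [mul_assoc]
  refine PEquiv.ext_mem fun φ χ => ?_
  rw [PEquiv.mem_trans, mem_spectralAction]
  constructor
  · rintro ⟨ψ, h1, h2⟩
    rw [mem_spectralAction] at h1 h2
    refine ⟨?_, fun e he => ?_⟩
    · rw [hsrc, ← h1.2 _ (inv_mul_self_idem s)]
      exact h2.1
    · rw [h2.2 e he, h1.2 _ (conj_idem s he), hconj]
  · rintro ⟨h1, h2⟩
    rw [hsrc] at h1
    -- The source of `s t` lies below `t⁻¹ t`, so `φ` is also in the domain of `t`.
    have h3 : t⁻¹ * (s⁻¹ * s) * t * (t⁻¹ * t) ∈ φ.filter := by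
      have h3 : t⁻¹ * (s⁻¹ * s) * t * (t⁻¹ * t) = t⁻¹ * (s⁻¹ * s) * (t * t⁻¹ * t) := by
        simp only [mul_assoc]
      rwa [h3, mul_inv_mul']
    obtain ⟨ψ, hψ⟩ := exists_mem_spectralAction
      ((Spectrum.mul_mem_filter (conj_idem t (inv_mul_self_idem s)) (inv_mul_self_idem t)).1 h3).2
    refine ⟨ψ, hψ, ?_⟩
    rw [mem_spectralAction] at hψ ⊢
    refine ⟨(hψ.2 _ (inv_mul_self_idem s)).2 h1, fun e he => ?_⟩
    rw [h2 e he, hψ.2 _ (conj_idem s he), hconj]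

theorem mem_spectralAction_idem {e : S} (he : e * e = e) {φ ψ : Spectrum S} :
    ψ ∈ spectralAction e φ ↔ e ∈ φ.filter ∧ ψ = φ := by
  have hconj : ∀ f, f * f = f → (e⁻¹ * f * e ∈ φ.filter ↔ e ∈ φ.filter ∧ f ∈ φ.filter) :=
    fun f hf => by
      rw [inv_eq_self_of_idem he, Spectrum.mul_mem_filter (idem_mul he hf) he,
        Spectrum.mul_mem_filter he hf]
      tauto
  rw [mem_spectralAction, inv_eq_self_of_idem he, he]
  refine and_congr_right fun h => ⟨fun h' => ?_, ?_⟩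
  · refine Spectrum.ext_filter fun f hf => ?_
    have h1 := hconj f hf
    rw [inv_eq_self_of_idem he] at h1
    rw [h' f hf, h1]
    tauto
  · rintro rfl f hf
    have h1 := hconj f hf
    rw [inv_eq_self_of_idem he] at h1
    tauto

theorem ne_zero_of_mem_spectralAction {s : S} {φ ψ : Spectrum S} (h : ψ ∈ spectralAction s φ) :
    s ≠ 0 := by
  rintro rfl
  refine φ.zero_notMem_filter ?_
  have := (mem_spectralAction.1 h).1
  rwa [mul_zero] at this

/-- The domain is given by a single coordinate, and the pushed character has coordinates that are
evaluations of `φ`; both depend continuously on `φ`. -/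
theorem isOpen_preimage_spectralAction (s : S) {V : Set (Spectrum S)} (hV : IsOpen V) :
    IsOpen {φ | ∃ ψ ∈ V, ψ ∈ spectralAction s φ} := by
  obtain ⟨W, hW, rfl⟩ := isOpen_induced_iff.1 hV
  have hc : Continuous (Spectrum.toFun : Spectrum S → Idem S → Bool) := continuous_induced_dom
  have hev : ∀ e, Continuous fun φ : Spectrum S => φ.toFun e := fun e =>
    (continuous_apply e).comp hc
  have h1 : IsOpen {φ : Spectrum S | φ.toFun (src s s⁻¹ (mul_inv_mul' s)) = true} :=
    (isOpen_discrete {true}).preimage (hev _)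
  have h2 : IsOpen {φ : Spectrum S |
      (fun e => φ.toFun (conj s s⁻¹ (mul_inv_mul' s) (inv_mul_inv' s) e)) ∈ W} :=
    hW.preimage (continuous_pi fun e => hev _)
  convert h1.inter h2 using 1
  ext φ
  constructor
  · rintro ⟨ψ, hψ, h⟩
    change ψ ∈ dite _ _ _ at h
    split_ifs at h with h3
    · obtain rfl := Option.mem_some_iff.1 h
      exact ⟨h3, hψ⟩
    · simp at h
  · rintro ⟨h3, h4⟩
    exact ⟨_, h4, dif_pos h3⟩

end Filters

/-! ### The partial action induced by an idempotent pure partial homomorphism. -/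

section InducedAction

variable {S : Type*} [InverseSemigroupWithZero S] {G : Type*} [Group G] {d : S → WithZero G}

/-- Restricting `s` to an idempotent in the filter of `φ` does not change its effect on `φ`, and
`s`, `t` coincide once each is restricted to the source of the other. This makes the join well
defined. -/
theorem spectralAction_unique (h0 : VanishesOnlyAtZero d) (hi : IsIdempotentPure d)
    (hm : IsPartialHom d) {s t : S} (hst : d s = d t) {φ ψ χ : Spectrum S}
    (hψ : ψ ∈ spectralAction s φ) (hχ : χ ∈ spectralAction t φ) : ψ = χ := by
  rw [mem_spectralAction] at hψ hχ
  have hs := inv_mul_self_idem s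
  have ht := inv_mul_self_idem t
  have hmem := (Spectrum.mul_mem_filter hs ht).2 ⟨hψ.1, hχ.1⟩
  have h := mul_src_mul_src_eq h0 hi hm hst fun h => φ.zero_notMem_filter (h ▸ hmem)
  have key : ∀ (s f : S), f * f = f → f ∈ φ.filter → ∀ e, e * e = e →
      (s⁻¹ * e * s ∈ φ.filter ↔ (s * f)⁻¹ * e * (s * f) ∈ φ.filter) := by
    intro s f hf hfφ e he
    have h1 : (s * f)⁻¹ * e * (s * f) = f * (s⁻¹ * e * s) * f := by
      rw [mul_inv_rev', inv_eq_self_of_idem hf]; simp only [mul_assoc]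
    rw [h1, Spectrum.mul_mem_filter (idem_mul hf (conj_idem s he)) hf,
      Spectrum.mul_mem_filter hf (conj_idem s he)]
    tauto
  refine Spectrum.ext_filter fun e he => ?_
  rw [hψ.2 e he, hχ.2 e he, key s _ ht hχ.1 e he, key t _ hs hψ.1 e he, h]

open Classical in
/-- The join of the partial homeomorphisms by which the elements of degree `g` act on the
spectrum. -/
noncomputable def spectralJoin (h0 : VanishesOnlyAtZero d) (hi : IsIdempotentPure d)
    (hm : IsPartialHom d) (g : G) : Spectrum S ≃. Spectrum S where
  toFun φ := if h : ∃ ψ s, d s = g ∧ ψ ∈ spectralAction s φ then some h.choose else none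
  invFun ψ := if h : ∃ φ s, d s = g ∧ ψ ∈ spectralAction s φ then some h.choose else none
  inv φ ψ := by
    -- Injectivity of the join is its single-valuedness for the inverse elements.
    have key : ∀ {s t : S} {φ ψ χ : Spectrum S}, d s = g → d t = g →
        χ ∈ spectralAction s φ → χ ∈ spectralAction t ψ → φ = ψ := by
      intro s t φ ψ χ hs ht hφ hψ
      rw [← PEquiv.mem_iff_mem, ← spectralAction_inv] at hφ hψ
      refine spectralAction_unique h0 hi hm ?_ hφ hψ
      rw [map_inv_of_isPartialHom h0 hm, map_inv_of_isPartialHom h0 hm, hs, ht]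
    constructor
    · intro h
      split_ifs at h with h1
      · obtain rfl := Option.mem_some_iff.1 h
        have h2 : ∃ ψ' s, d s = g ∧ ψ' ∈ spectralAction s h1.choose := ⟨ψ, h1.choose_spec⟩
        rw [dif_pos h2]
        refine Option.mem_some_iff.2 ?_
        obtain ⟨s, hs, h3⟩ := h1.choose_spec
        obtain ⟨t, ht, h4⟩ := h2.choose_spec
        exact spectralAction_unique h0 hi hm (ht.trans hs.symm) h4 h3
    · intro h
      split_ifs at h with h1
      · obtain rfl := Option.mem_some_iff.1 h
        have h2 : ∃ φ' s, d s = g ∧ h1.choose ∈ spectralAction s φ' := ⟨φ, h1.choose_spec⟩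
        rw [dif_pos h2]
        refine Option.mem_some_iff.2 ?_
        obtain ⟨s, hs, h3⟩ := h1.choose_spec
        obtain ⟨t, ht, h4⟩ := h2.choose_spec
        exact key ht hs h4 h3

theorem mem_spectralJoin (h0 : VanishesOnlyAtZero d) (hi : IsIdempotentPure d)
    (hm : IsPartialHom d) {g : G} {φ ψ : Spectrum S} :
    ψ ∈ spectralJoin h0 hi hm g φ ↔ ∃ s, d s = g ∧ ψ ∈ spectralAction s φ := by
  classical
  change ψ ∈ dite _ _ _ ↔ _
  constructor
  · intro h
    split_ifs at h with h1
    · obtain rfl := Option.mem_some_iff.1 h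
      exact h1.choose_spec
    · simp at h
  · rintro ⟨s, hs, h⟩
    have h1 : ∃ ψ s, d s = g ∧ ψ ∈ spectralAction s φ := ⟨ψ, s, hs, h⟩
    rw [dif_pos h1, Option.mem_some_iff]
    obtain ⟨t, ht, h2⟩ := h1.choose_spec
    exact spectralAction_unique h0 hi hm (ht.trans hs.symm) h2 h

/-- The partial action on the spectrum induced by an idempotent pure partial homomorphism. -/
noncomputable def spectralPartialAction (h0 : VanishesOnlyAtZero d) (hi : IsIdempotentPure d)
    (hm : IsPartialHom d) : TopPartialAction G (Spectrum S) where
  act := spectralJoin h0 hi hm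
  act_one := by
    refine PEquiv.ext_mem fun φ ψ => ?_
    rw [mem_spectralJoin, PEquiv.refl_apply, Option.mem_some_iff]
    constructor
    · rintro ⟨s, hs, h⟩
      exact ((mem_spectralAction_idem ((hi s).1 hs).2).1 h).2.symm
    · rintro rfl
      obtain ⟨e, he⟩ := φ.exists_eq_true
      have he' := (Spectrum.mem_filter e.idem).2 he
      refine ⟨e.val, (hi _).2 ⟨fun h => φ.zero_notMem_filter (h ▸ he'), e.idem⟩, ?_⟩
      exact (mem_spectralAction_idem e.idem).2 ⟨he', rfl⟩
  act_inv g := by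
    refine PEquiv.ext_mem fun φ ψ => ?_
    rw [PEquiv.mem_iff_mem, mem_spectralJoin, mem_spectralJoin]
    constructor
    · rintro ⟨s, hs, h⟩
      refine ⟨s⁻¹, by rw [map_inv_of_isPartialHom h0 hm, hs, WithZero.coe_inv, inv_inv], ?_⟩
      rwa [spectralAction_inv, PEquiv.mem_iff_mem]
    · rintro ⟨s, hs, h⟩
      refine ⟨s⁻¹, by rw [map_inv_of_isPartialHom h0 hm, hs, WithZero.coe_inv], ?_⟩
      rwa [spectralAction_inv, PEquiv.mem_iff_mem]
  act_mul g h := by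
    rw [PEquiv.le_def]
    intro φ χ hχ
    obtain ⟨ψ, h1, h2⟩ := (PEquiv.mem_trans _ _ _ _).1 hχ
    obtain ⟨t, ht, h1⟩ := (mem_spectralJoin h0 hi hm).1 h1
    obtain ⟨s, hs, h2⟩ := (mem_spectralJoin h0 hi hm).1 h2
    have h3 : χ ∈ spectralAction (s * t) φ := by
      rw [← spectralAction_mul]
      exact (PEquiv.mem_trans _ _ _ _).2 ⟨ψ, h1, h2⟩
    refine (mem_spectralJoin h0 hi hm).2 ⟨s * t, ?_, h3⟩
    rw [hm _ _ (ne_zero_of_mem_spectralAction h3), hs, ht, WithZero.coe_mul]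
  isOpen_preimage g V hV := by
    have h : {φ | ∃ ψ ∈ V, ψ ∈ spectralJoin h0 hi hm g φ} =
        ⋃ s ∈ {s | d s = g}, {φ | ∃ ψ ∈ V, ψ ∈ spectralAction s φ} := by
      ext φ
      simp only [mem_spectralJoin, Set.mem_ofPred_eq, Set.mem_iUnion]
      tauto
    rw [h]
    exact isOpen_biUnion fun s _ => isOpen_preimage_spectralAction s hV

theorem isInducedBy_spectralPartialAction (h0 : VanishesOnlyAtZero d) (hi : IsIdempotentPure d)
    (hm : IsPartialHom d) : (spectralPartialAction h0 hi hm).IsInducedBy d :=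
  fun _ _ _ => mem_spectralJoin h0 hi hm

/-- The composite is the join over products `s t` of elements of degrees `g` and `h`; it is all of
`α_{gh}` once every element of degree `gh` is such a product. -/
theorem trans_act_eq_of_exists_factorization {α : TopPartialAction G (Spectrum S)}
    (hα : α.IsInducedBy d) {g h : G}
    (H : ∀ r : S, d r = ((g * h : G) : WithZero G) → ∃ s t, d s = g ∧ d t = h ∧ s * t = r) :
    (α.act h).trans (α.act g) = α.act (g * h) := by
  refine le_antisymm (α.act_mul g h) (PEquiv.le_def.2 fun φ χ hχ => ?_)
  obtain ⟨r, hr, hχ⟩ := (hα _ _ _).1 hχ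
  obtain ⟨s, t, hs, ht, rfl⟩ := H r hr
  rw [← spectralAction_mul] at hχ
  obtain ⟨ψ, h1, h2⟩ := (PEquiv.mem_trans _ _ _ _).1 hχ
  exact (PEquiv.mem_trans _ _ _ _).2
    ⟨ψ, (hα _ _ _).2 ⟨t, ht, h1⟩, (hα _ _ _).2 ⟨s, hs, h2⟩⟩

/-- A character in both ranges would contain `s s⁻¹` and `t t⁻¹` in its filter, hence also their
product `0`. -/
theorem disjoint_range_of_forall_mul_eq_zero {α : TopPartialAction G (Spectrum S)}
    (hα : α.IsInducedBy d) {g h : G}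
    (H : ∀ s t : S, d s = g → d t = h → (s * s⁻¹) * (t * t⁻¹) = 0) :
    Disjoint (α.range g) (α.range h) := by
  have key : ∀ {s : S} {φ ψ : Spectrum S}, ψ ∈ spectralAction s φ → s * s⁻¹ ∈ ψ.filter := by
    intro s φ ψ h
    rw [← PEquiv.mem_iff_mem, ← spectralAction_inv, mem_spectralAction, inv_inv'] at h
    exact h.1
  refine Set.disjoint_left.2 fun ψ h1 h2 => ?_
  obtain ⟨φ, h1⟩ := h1
  obtain ⟨φ', h2⟩ := h2
  obtain ⟨s, hs, h1⟩ := (hα _ _ _).1 h1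
  obtain ⟨t, ht, h2⟩ := (hα _ _ _).1 h2
  refine ψ.zero_notMem_filter ?_
  rw [← H s t hs ht]
  exact (Spectrum.mul_mem_filter (mul_inv_self_idem s) (mul_inv_self_idem t)).2 ⟨key h1, key h2⟩

end InducedAction

/-! ### The universal group. -/

section Universal

variable {S : Type*} [InverseSemigroupWithZero S]

theorem universalMap_of_ne_zero {s : S} (h : s ≠ 0) :
    universalMap S s = ((PresentedGroup.of ⟨s, h⟩ : UniversalGroup S) : WithZero _) := dif_pos h

theorem vanishesOnlyAtZero_universalMap : VanishesOnlyAtZero (universalMap S) := fun s => by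
  constructor
  · intro h
    by_contra hs
    rw [universalMap_of_ne_zero hs] at h
    exact WithZero.coe_ne_zero h
  · rintro rfl
    exact dif_neg (not_not.2 rfl)

theorem isPartialHom_universalMap : IsPartialHom (universalMap S) := fun s t h => by
  have hs : s ≠ 0 := fun h' => h (by rw [h', zero_mul])
  have ht : t ≠ 0 := fun h' => h (by rw [h', mul_zero])
  rw [universalMap_of_ne_zero h, universalMap_of_ne_zero hs, universalMap_of_ne_zero ht,
    ← WithZero.coe_mul, WithZero.coe_inj]
  refine (PresentedGroup.mk_eq_mk_of_mul_inv_mem (rels := universalRels S)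
    (x := FreeGroup.of ⟨s, hs⟩ * FreeGroup.of ⟨t, ht⟩) ?_).symm
  exact ⟨⟨s, hs⟩, ⟨t, ht⟩, h, rfl⟩

/-- A partial homomorphism factors through the universal group. -/
theorem exists_lift_universalGroup {G : Type*} [Group G] {d : S → WithZero G}
    (h0 : VanishesOnlyAtZero d) (hm : IsPartialHom d) :
    ∃ f : UniversalGroup S →* G, ∀ s, d s = WithZero.map' f (universalMap S s) := by
  have hne : ∀ s : {s : S // s ≠ 0}, d s.1 ≠ 0 := fun s h => s.2 ((h0 _).1 h)
  refine ⟨PresentedGroup.toGroup (f := fun s => WithZero.unzero (hne s)) ?_, fun s => ?_⟩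
  · rintro r ⟨s, t, h, rfl⟩
    simp only [map_mul, map_inv, FreeGroup.lift_apply_of]
    rw [mul_inv_eq_one, ← WithZero.coe_inj, WithZero.coe_mul, WithZero.coe_unzero,
      WithZero.coe_unzero, WithZero.coe_unzero, hm _ _ h]
  · by_cases hs : s = 0
    · subst hs
      rw [(h0 0).2 rfl, (vanishesOnlyAtZero_universalMap 0).2 rfl, map_zero]
    · rw [universalMap_of_ne_zero hs, WithZero.map'_coe, PresentedGroup.toGroup.of,
        WithZero.coe_unzero]

end Universal

end InverseSemigroupWithZero

/-! ### Positive words and cancellation in the free group. -/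

namespace FreeGroup

variable {A : Type*}

theorem prod_map_of_eq_mk (w : List A) : (w.map of).prod = mk (w.map (·, true)) := by
  induction w with
  | nil => rfl
  | cons a w ih => rw [List.map_cons, List.prod_cons, ih, of, mul_mk]; rfl

theorem isReduced_map_true (w : List A) : IsReduced (w.map (·, true)) := by
  rw [IsReduced, List.isChain_map]
  exact (List.pairwise_of_forall fun _ _ _ => rfl).isChain

variable [DecidableEq A]

theorem toWord_prod_map_of (w : List A) : ((w.map of).prod).toWord = w.map (·, true) := by
  rw [prod_map_of_eq_mk, toWord_mk, (isReduced_map_true w).reduce_eq]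

theorem prod_map_of_injective : Function.Injective fun w : List A => (w.map of).prod := by
  intro v w h
  have h' := congrArg toWord h
  rw [toWord_prod_map_of, toWord_prod_map_of] at h'
  exact List.map_injective_iff.2 (fun _ _ h => congrArg Prod.fst h) h'

/-- Two words decompose along a common suffix so that the remaining parts do not cancel. -/
theorem exists_common_suffix (x y : List A) : ∃ m n w : List A, y = m ++ w ∧ x = n ++ w ∧
    IsReduced (m.map (·, true) ++ invRev (n.map (·, true))) := by
  induction x using List.reverseRecOn generalizing y with
  | nil => exact ⟨y, [], [], by simp, rfl, by simpa using isReduced_map_true y⟩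
  | append_singleton x a ih =>
    rcases List.eq_nil_or_concat y with rfl | ⟨y, b, rfl⟩
    · refine ⟨[], x ++ [a], [], rfl, by simp, ?_⟩
      rw [List.map_nil, List.nil_append, ← toWord_prod_map_of, ← toWord_inv]
      exact isReduced_toWord
    · by_cases hab : a = b
      · subst hab
        obtain ⟨m, n, w, rfl, rfl, h⟩ := ih y
        exact ⟨m, n, w ++ [a], by simp, by simp, h⟩
      · refine ⟨y ++ [b], x ++ [a], [], by simp, by simp, ?_⟩
        -- At the junction `b` meets `a⁻¹`, which does not cancel because `a ≠ b`.
        refine List.IsChain.append (isReduced_map_true _) ?_ ?_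
        · rw [← toWord_prod_map_of, ← toWord_inv]
          exact isReduced_toWord
        · simp [invRev, Ne.symm hab]

/-- If two words with the same last letter differ by a reduced product `u v`, the cut between `u`
and `v` falls into one of the two words, in front of its last letter. -/
theorem positive_or_negative_of_isReduced {x y : List A} (hx : x ≠ [])
    (hl : y.getLast? = x.getLast?) {u v : FreeGroup A} (hr : IsReduced (u.toWord ++ v.toWord))
    (h : (y.map of).prod = u * v * (x.map of).prod) :
    (∃ m z, z ≠ [] ∧ u = (m.map of).prod ∧ y = m ++ z) ∨
      ∃ m z, z ≠ [] ∧ v⁻¹ = (m.map of).prod ∧ x = m ++ z := by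
  obtain ⟨x, a, rfl⟩ := (List.eq_nil_or_concat x).resolve_left hx
  have hy : y ≠ [] := by rintro rfl; simp at hl
  obtain ⟨y, b, rfl⟩ := (List.eq_nil_or_concat y).resolve_left hy
  obtain rfl : b = a := by simpa using hl
  simp only [List.concat_eq_append] at *
  -- The common last letter is set aside before the suffix is stripped, so the remainders `… ++ w ++
  -- [b]` below are nonempty.
  obtain ⟨m, n, w, rfl, rfl, hmn⟩ := exists_common_suffix x y
  have h1 : u * v = mk (m.map (·, true) ++ invRev (n.map (·, true))) := by
    rw [← mul_mk, ← inv_mk, ← prod_map_of_eq_mk, ← prod_map_of_eq_mk]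
    simp only [List.map_append, List.prod_append] at h
    have h2 := eq_mul_inv_of_mul_eq h.symm
    rw [h2]; group
  have h2 : u.toWord ++ v.toWord = m.map (·, true) ++ invRev (n.map (·, true)) := by
    rw [← hr.reduce_eq, ← toWord_mul, h1, toWord_mk, hmn.reduce_eq]
  -- Two cuts of one reduced word: either `u` is a prefix of the positive part `m`, or `v` is a
  -- suffix of `n⁻¹`, so that `v⁻¹` is a prefix of `n`.
  rcases List.append_eq_append_iff.1 h2 with ⟨c, hc, -⟩ | ⟨c, -, hc⟩
  · obtain ⟨m₁, m₂, rfl, h3, -⟩ := List.map_eq_append_iff.1 hc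
    refine Or.inl ⟨m₁, m₂ ++ w ++ [b], by simp, ?_, by simp⟩
    rw [← toWord_inj, toWord_prod_map_of, h3]
  · have hc' := congrArg invRev hc
    rw [invRev_invRev] at hc'
    have h4 : invRev (c ++ v.toWord) = invRev v.toWord ++ invRev c := by simp [invRev]
    rw [h4] at hc'
    obtain ⟨n₁, n₂, rfl, h3, -⟩ := List.map_eq_append_iff.1 hc'
    refine Or.inr ⟨n₁, n₂ ++ w ++ [b], by simp, ?_, by simp⟩
    rw [← toWord_inj, toWord_prod_map_of, h3, toWord_inv]

end FreeGroup

open InverseSemigroupWithZero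

/-! ### Calculus in the inverse hull. -/

section Hull

variable {S : Type*} [SemigroupWithZero S] [ZeroLeftCancellative S]

theorem mem_regularRep {s : S} {x y : {x : S // x ≠ 0}} : y ∈ regularRep s x ↔ s * x.1 = y.1 := by
  classical
  change y ∈ dite _ _ _ ↔ _
  constructor
  · intro h
    split_ifs at h
    · exact congrArg Subtype.val (Option.mem_some_iff.1 h)
    · simp at h
  · intro h
    rw [dif_pos (show s * x.1 ≠ 0 from h ▸ y.2)]
    exact Option.mem_some_iff.2 (Subtype.ext h)

namespace InverseHull

theorem ext_mem {f g : InverseHull S} (h : ∀ x y, y ∈ f.val x ↔ y ∈ g.val x) : f = g :=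
  InverseHull.ext (PEquiv.ext_mem h)

theorem mem_mul {f g : InverseHull S} {x z : {x : S // x ≠ 0}} :
    z ∈ (f * g).val x ↔ ∃ y, y ∈ g.val x ∧ z ∈ f.val y := PEquiv.mem_trans _ _ _ _

theorem mem_inv {f : InverseHull S} {x y : {x : S // x ≠ 0}} : y ∈ f⁻¹.val x ↔ x ∈ f.val y :=
  PEquiv.mem_iff_mem f.val

theorem notMem_zero {x y : {x : S // x ≠ 0}} : y ∉ (0 : InverseHull S).val x := by
  intro h
  exact absurd (Option.mem_def.1 h) (by rintro ⟨⟩)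

theorem ne_zero_iff {f : InverseHull S} : f ≠ 0 ↔ ∃ x y, y ∈ f.val x := by
  constructor
  · intro h
    by_contra! hn
    exact h (ext_mem fun x y => iff_of_false (hn x y) notMem_zero)
  · rintro ⟨x, y, h⟩ rfl
    exact notMem_zero h

theorem mul_self_eq_iff {f : InverseHull S} : f * f = f ↔ ∀ x y, y ∈ f.val x → x = y := by
  refine ⟨fun h x y => PEquiv.eq_of_idem (congrArg val h), fun h => ext_mem fun x y => ?_⟩
  rw [mem_mul]
  constructor
  · rintro ⟨z, h1, h2⟩
    rwa [h x z h1]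
  · intro hy
    obtain rfl := h x y hy
    exact ⟨x, hy, hy⟩

/-- `r r⁻¹` is the identity on the range of `r`, which contains that of `s`. -/
theorem mul_inv_mul_eq {r s : InverseHull S} (h : ∀ x y, y ∈ s.val x → ∃ z, y ∈ r.val z) :
    r * (r⁻¹ * s) = s := by
  refine ext_mem fun x y => ?_
  simp only [mem_mul, mem_inv]
  constructor
  · rintro ⟨z, ⟨y', h1, h2⟩, h3⟩
    rwa [Option.mem_unique h3 h2]
  · intro hy
    obtain ⟨z, hz⟩ := h x y hy
    exact ⟨z, ⟨y, hy, hz⟩, hz⟩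

theorem hullTheta_mul (s t : S) : hullTheta (s * t) = hullTheta s * hullTheta t := by
  refine ext_mem fun x y => ?_
  rw [mem_mul]
  change y ∈ regularRep (s * t) x ↔ ∃ z, z ∈ regularRep t x ∧ y ∈ regularRep s z
  simp only [mem_regularRep]
  constructor
  · intro h
    refine ⟨⟨t * x.1, fun h' => y.2 ?_⟩, rfl, by rw [← h, mul_assoc]⟩
    rw [← h, mul_assoc, h', mul_zero]
  · rintro ⟨z, h1, h2⟩
    rw [mul_assoc, h1, h2]

theorem hullTheta_zero : hullTheta (0 : S) = 0 := InverseHull.ext regularRep_zero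

/-- Partial homomorphisms of the inverse hull are determined on the generators. -/
theorem isPartialHom_ext {G : Type*} [Group G] {d₁ d₂ : InverseHull S → WithZero G}
    (h₁ : VanishesOnlyAtZero d₁) (m₁ : IsPartialHom d₁) (h₂ : VanishesOnlyAtZero d₂)
    (m₂ : IsPartialHom d₂) (h : ∀ s, d₁ (hullTheta s) = d₂ (hullTheta s)) : d₁ = d₂ := by
  funext f
  obtain ⟨f, hf⟩ := f
  induction hf with
  | gen s => exact h s
  | comp f g hf hg ihf ihg =>
    by_cases h0 : (⟨f, hf⟩ : InverseHull S) * ⟨g, hg⟩ = 0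
    · exact ((h₁ _).2 h0).trans ((h₂ _).2 h0).symm
    · exact (m₁ _ _ h0).trans (by rw [ihf, ihg]; exact (m₂ _ _ h0).symm)
  | inv f hf ih =>
    exact (map_inv_of_isPartialHom h₁ m₁ ⟨f, hf⟩).trans
      (by rw [ih]; exact (map_inv_of_isPartialHom h₂ m₂ ⟨f, hf⟩).symm)

end InverseHull

end Hull

/-! ### The subshift semigroup and the degree map. -/

section Subshift

variable {A : Type*} [TopologicalSpace A] {X : Subshift A ℕ}

/-- Occurrences sit in infinite words and so extend to the right. The empty word is not in the
domain of `θ_w`, so this is what makes `θ_w` nonzero. -/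
theorem exists_append_singleton_mem_subshiftLanguage {w : List A} (hw : w ∈ subshiftLanguage X) :
    ∃ a, w ++ [a] ∈ subshiftLanguage X := by
  obtain ⟨-, x, hx, k, hk⟩ := hw
  refine ⟨x (k + w.length), by simp, x, hx, k, fun i hi => ?_⟩
  rw [List.length_append, List.length_singleton] at hi
  rw [List.getElem_append]
  split_ifs with h
  · exact hk i h
  · obtain rfl : i = w.length := by omega
    simp

namespace SubshiftSemigroup

/-- The word underlying a nonzero element of the subshift semigroup. -/
def toWord : {x : SubshiftSemigroup X // x ≠ 0} → List A
  | ⟨word w _, _⟩ => w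
  | ⟨zero, h⟩ => absurd rfl h

theorem toWord_mem (x : {x : SubshiftSemigroup X // x ≠ 0}) : toWord x ∈ subshiftLanguage X := by
  rcases x with ⟨_ | ⟨w, hw⟩, h⟩
  · exact absurd rfl h
  · exact hw

theorem word_ne_zero {w : List A} (hw : w ∈ subshiftLanguage X) : word w hw ≠ 0 := by
  rintro ⟨⟩

theorem toWord_injective :
    Function.Injective (toWord : {x : SubshiftSemigroup X // x ≠ 0} → List A) := by
  rintro ⟨_ | ⟨v, hv⟩, h⟩ ⟨_ | ⟨w, hw⟩, h'⟩ hvw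
  · exact absurd rfl h
  · exact absurd rfl h
  · exact absurd rfl h'
  · obtain rfl : v = w := hvw
    rfl

theorem exists_toWord_eq {w : List A} (hw : w ∈ subshiftLanguage X) :
    ∃ x : {x : SubshiftSemigroup X // x ≠ 0}, toWord x = w := ⟨⟨word w hw, word_ne_zero hw⟩, rfl⟩

theorem word_mul_word {u v : List A} (hu : u ∈ subshiftLanguage X) (hv : v ∈ subshiftLanguage X)
    (h : u ++ v ∈ subshiftLanguage X) : word u hu * word v hv = word (u ++ v) h := ofWord_pos h

theorem mem_regularRep_word {u : List A} {hu : u ∈ subshiftLanguage X}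
    {x y : {x : SubshiftSemigroup X // x ≠ 0}} :
    y ∈ regularRep (word u hu) x ↔ toWord y = u ++ toWord x := by
  rw [mem_regularRep]
  rcases x with ⟨_ | ⟨v, hv⟩, h⟩
  · exact absurd rfl h
  rcases y with ⟨_ | ⟨w, hw⟩, h'⟩
  · exact absurd rfl h'
  change ofWord X (u ++ v) = word w hw ↔ w = u ++ v
  constructor
  · intro h1
    by_cases h2 : u ++ v ∈ subshiftLanguage X
    · rw [ofWord_pos h2] at h1
      injection h1 with h1
      exact h1.symm
    · rw [ofWord_neg h2] at h1
      cases h1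
  · rintro rfl
    exact ofWord_pos hw

theorem mem_hullTheta_word {u : List A} {hu : u ∈ subshiftLanguage X}
    {x y : {x : SubshiftSemigroup X // x ≠ 0}} :
    y ∈ (hullTheta (word u hu)).val x ↔ toWord y = u ++ toWord x := mem_regularRep_word

theorem hullTheta_word_ne_zero {u : List A} (hu : u ∈ subshiftLanguage X) :
    hullTheta (word u hu) ≠ 0 := by
  obtain ⟨a, ha⟩ := exists_append_singleton_mem_subshiftLanguage hu
  obtain ⟨x, hx⟩ := exists_toWord_eq (subshiftLanguage_right (by simp) ha)
  obtain ⟨y, hy⟩ := exists_toWord_eq ha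
  exact InverseHull.ne_zero_iff.2 ⟨x, y, mem_hullTheta_word.2 (by rw [hx, hy])⟩

/-- The element of the free group underlying a nonzero element of the subshift semigroup. -/
def toFreeGroup (x : {x : SubshiftSemigroup X // x ≠ 0}) : FreeGroup A :=
  ((toWord x).map FreeGroup.of).prod

theorem toFreeGroup_injective [DecidableEq A] : Function.Injective
    (toFreeGroup : {x : SubshiftSemigroup X // x ≠ 0} → FreeGroup A) :=
  FreeGroup.prod_map_of_injective.comp toWord_injective

/-- Each element of the inverse hull acts as left translation by an element of the free group, and
preserves last letters. -/
theorem memHull_translation {f : {x : SubshiftSemigroup X // x ≠ 0} ≃. {x // x ≠ 0}}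
    (hf : MemHull _ f) : ∃ g : FreeGroup A, ∀ x y, y ∈ f x →
      toFreeGroup y = g * toFreeGroup x ∧ (toWord y).getLast? = (toWord x).getLast? := by
  induction hf with
  | gen s =>
    rcases s with _ | ⟨u, hu⟩
    -- The empty map is a translation by anything; `1` is a dummy value.
    · refine ⟨1, fun x y h => ?_⟩
      have h' : y ∈ regularRep (0 : SubshiftSemigroup X) x := h
      rw [regularRep_zero] at h'
      simp at h'
    · refine ⟨(u.map FreeGroup.of).prod, fun x y h => ?_⟩
      rw [mem_regularRep_word] at h
      rw [toFreeGroup, toFreeGroup, h, List.map_append, List.prod_append]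
      exact ⟨rfl, List.getLast?_append_of_ne_nil _ (toWord_mem x).1⟩
  | comp f g _ _ ihf ihg =>
    obtain ⟨a, ha⟩ := ihf
    obtain ⟨b, hb⟩ := ihg
    refine ⟨a * b, fun x z h => ?_⟩
    obtain ⟨y, h1, h2⟩ := (PEquiv.mem_trans _ _ _ _).1 h
    rw [(ha y z h2).1, (hb x y h1).1, (ha y z h2).2, (hb x y h1).2, mul_assoc]
    exact ⟨rfl, rfl⟩
  | inv f _ ih =>
    obtain ⟨a, ha⟩ := ih
    refine ⟨a⁻¹, fun x y h => ?_⟩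
    have h' := ha y x (f.mem_iff_mem.1 h)
    rw [h'.1, h'.2, inv_mul_cancel_left]
    exact ⟨rfl, rfl⟩

open Classical in
/-- The degree of an element of the inverse hull: the element of the free group by which it
translates, and `0` for the empty map. -/
noncomputable def degree (f : InverseHull (SubshiftSemigroup X)) : WithZero (FreeGroup A) :=
  if f = 0 then 0 else ((memHull_translation f.mem).choose : WithZero (FreeGroup A))

/-- Left translation is free, so one pair in the graph determines the degree, whatever element was
chosen. -/
theorem degree_eq_coe_iff {f : InverseHull (SubshiftSemigroup X)}
    {x y : {x : SubshiftSemigroup X // x ≠ 0}} (h : y ∈ f.val x) {g : FreeGroup A} :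
    degree f = g ↔ toFreeGroup y = g * toFreeGroup x := by
  rw [degree, if_neg (InverseHull.ne_zero_iff.2 ⟨x, y, h⟩), WithZero.coe_inj,
    ((memHull_translation f.mem).choose_spec x y h).1, mul_left_inj]

theorem getLast?_toWord_eq {f : InverseHull (SubshiftSemigroup X)}
    {x y : {x : SubshiftSemigroup X // x ≠ 0}} (h : y ∈ f.val x) :
    (toWord y).getLast? = (toWord x).getLast? :=
  ((memHull_translation f.mem).choose_spec x y h).2

theorem vanishesOnlyAtZero_degree :
    VanishesOnlyAtZero (degree : InverseHull (SubshiftSemigroup X) → _) := fun f => by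
  by_cases h : f = 0 <;> simp [degree, h]

theorem isIdempotentPure_degree [DecidableEq A] :
    IsIdempotentPure (degree : InverseHull (SubshiftSemigroup X) → _) := fun f => by
  rw [InverseHull.mul_self_eq_iff]
  constructor
  · intro h
    refine ⟨fun h0 => ?_, fun x y hxy => ?_⟩
    · rw [(vanishesOnlyAtZero_degree f).2 h0] at h
      exact zero_ne_one h
    · refine (toFreeGroup_injective ?_).symm
      rw [← WithZero.coe_one, degree_eq_coe_iff hxy, one_mul] at h
      exact h
  · rintro ⟨h0, h⟩
    obtain ⟨x, y, hxy⟩ := InverseHull.ne_zero_iff.1 h0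
    rw [← WithZero.coe_one, degree_eq_coe_iff hxy, h x y hxy, one_mul]

theorem exists_degree_eq_coe {f : InverseHull (SubshiftSemigroup X)} (h : f ≠ 0) :
    ∃ g : FreeGroup A, degree f = g :=
  ⟨_, if_neg h⟩

theorem isPartialHom_degree :
    IsPartialHom (degree : InverseHull (SubshiftSemigroup X) → _) := fun s t h => by
  obtain ⟨x, z, hxz⟩ := InverseHull.ne_zero_iff.1 h
  obtain ⟨y, hxy, hyz⟩ := InverseHull.mem_mul.1 hxz
  obtain ⟨a, ha⟩ := exists_degree_eq_coe (InverseHull.ne_zero_iff.2 ⟨y, z, hyz⟩)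
  obtain ⟨b, hb⟩ := exists_degree_eq_coe (InverseHull.ne_zero_iff.2 ⟨x, y, hxy⟩)
  rw [ha, hb, ← WithZero.coe_mul, degree_eq_coe_iff hxz, (degree_eq_coe_iff hyz).1 ha,
    (degree_eq_coe_iff hxy).1 hb, mul_assoc]

theorem degree_hullTheta (s : SubshiftSemigroup X) :
    degree (hullTheta s) = s.toFreeGroupWithZero := by
  rcases s with _ | ⟨u, hu⟩
  · exact (vanishesOnlyAtZero_degree _).2 InverseHull.hullTheta_zero
  · obtain ⟨x, y, h⟩ := InverseHull.ne_zero_iff.1 (hullTheta_word_ne_zero hu)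
    refine (degree_eq_coe_iff h).2 ?_
    rw [toFreeGroup, mem_hullTheta_word.1 h, List.map_append, List.prod_append]
    rfl

/-- The inverse of the map `f` induced by `degree` is `k`, sending a letter to the class of its `θ`,
which is nonzero by `hA`. The two partial homomorphisms `universalMap` and `k ∘ degree` agree on
each `θ_u` by induction on `u`, hence everywhere. -/
theorem exists_universalGroup_equiv (hA : ∀ a : A, [a] ∈ subshiftLanguage X) :
    ∃ e : UniversalGroup (InverseHull (SubshiftSemigroup X)) ≃* FreeGroup A,
      ∀ s, degree s = WithZero.map' e.toMonoidHom (universalMap _ s) := by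
  obtain ⟨f, hf⟩ := exists_lift_universalGroup
    (vanishesOnlyAtZero_degree (X := X)) isPartialHom_degree
  let k : FreeGroup A →* UniversalGroup (InverseHull (SubshiftSemigroup X)) :=
    FreeGroup.lift fun a => PresentedGroup.of ⟨_, hullTheta_word_ne_zero (hA a)⟩
  have hk : ∀ a, universalMap _ (hullTheta (word [a] (hA a))) =
      WithZero.map' k (degree (hullTheta (word [a] (hA a)))) := by
    intro a
    rw [degree_hullTheta, universalMap_of_ne_zero (hullTheta_word_ne_zero (hA a)),
      toFreeGroupWithZero, WithZero.map'_coe, List.map_singleton, List.prod_singleton,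
      FreeGroup.lift_apply_of]
  have key : universalMap (InverseHull (SubshiftSemigroup X)) =
      fun s => WithZero.map' k (degree s) := by
    refine InverseHull.isPartialHom_ext vanishesOnlyAtZero_universalMap isPartialHom_universalMap
      (fun s => ?_) (fun s t h => ?_) fun s => ?_
    · rw [map_eq_zero, vanishesOnlyAtZero_degree]
    · rw [isPartialHom_degree s t h, map_mul]
    · rcases s with _ | ⟨u, hu⟩
      · have h0 : hullTheta (zero : SubshiftSemigroup X) = 0 := InverseHull.hullTheta_zero
        rw [h0, (vanishesOnlyAtZero_universalMap _).2 rfl, (vanishesOnlyAtZero_degree _).2 rfl,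
          map_zero]
      · induction u with
        | nil => exact absurd rfl hu.1
        | cons a u ih =>
          by_cases hn : u = []
          · subst hn
            exact hk a
          · have hu' := subshiftLanguage_right (u := [a]) hn hu
            have h1 : hullTheta (word (a :: u) hu) =
                hullTheta (word [a] (hA a)) * hullTheta (word u hu') := by
              rw [← InverseHull.hullTheta_mul, word_mul_word (hA a) hu' hu]
              rfl
            have h2 := hullTheta_word_ne_zero hu
            rw [h1] at h2 ⊢
            rw [isPartialHom_universalMap _ _ h2, isPartialHom_degree _ _ h2, map_mul, hk,
              ih hu']
  refine ⟨MulEquiv.ofBijective f ⟨?_, fun g => ?_⟩, hf⟩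
  · have hkf : k.comp f = MonoidHom.id _ := by
      refine PresentedGroup.ext fun s => ?_
      have h := congrFun key s.1
      rw [hf, universalMap_of_ne_zero s.2, WithZero.map'_coe, WithZero.map'_coe,
        WithZero.coe_inj] at h
      exact h.symm
    exact Function.LeftInverse.injective (DFunLike.congr_fun hkf)
  · have hfk : f.comp k = MonoidHom.id _ := by
      refine FreeGroup.ext_hom _ _ fun a => ?_
      have h := hf (hullTheta (word [a] (hA a)))
      rw [degree_hullTheta, universalMap_of_ne_zero (hullTheta_word_ne_zero (hA a)),
        toFreeGroupWithZero, WithZero.map'_coe, List.map_singleton, List.prod_singleton,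
        WithZero.coe_inj] at h
      rw [MonoidHom.comp_apply, FreeGroup.lift_apply_of, ← h, MonoidHom.id_apply]
    exact ⟨k g, DFunLike.congr_fun hfk g⟩

/-- A positive left factor `u` of the degree of `s` can be split off if each word in the range of
`s` has the form `u z` with `z` nonempty. -/
theorem exists_left_factor {s : InverseHull (SubshiftSemigroup X)} (hs : s ≠ 0) (m : List A)
    (h : ∀ x y, y ∈ s.val x → ∃ z, z ≠ [] ∧ toWord y = m ++ z) :
    ∃ r : InverseHull (SubshiftSemigroup X),
      degree r = ((m.map FreeGroup.of).prod : FreeGroup A) ∧ r * (r⁻¹ * s) = s := by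
  -- The empty word has no `θ`; the idempotent `s s⁻¹`, of degree `1`, takes its place.
  by_cases hm : m = []
  · subst hm
    refine ⟨s * s⁻¹, ?_, ?_⟩
    · have h1 := mul_inv_self_ne_zero hs
      obtain ⟨x, y, h⟩ := InverseHull.ne_zero_iff.1 h1
      rw [degree_eq_coe_iff h,
        InverseHull.mul_self_eq_iff.1 (mul_inv_self_idem s) x y h]
      simp
    · rw [inv_eq_self_of_idem (mul_inv_self_idem s), mul_inv_mul', mul_inv_mul']
  · obtain ⟨x, y, hxy⟩ := InverseHull.ne_zero_iff.1 hs
    obtain ⟨z, -, hy⟩ := h x y hxy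
    have hm' : m ∈ subshiftLanguage X := subshiftLanguage_left hm (hy ▸ toWord_mem y)
    refine ⟨hullTheta (word m hm'), degree_hullTheta _,
      InverseHull.mul_inv_mul_eq fun x y hxy => ?_⟩
    obtain ⟨z, hz, hy⟩ := h x y hxy
    obtain ⟨z', rfl⟩ := exists_toWord_eq (subshiftLanguage_right hz (hy ▸ toWord_mem y))
    exact ⟨z', mem_hullTheta_word.2 hy⟩

/-- Which side the cut falls on is read off at one point of the graph of `r`. At any other point the
opposite alternative still yields the required prefix, so one factor works on all of `r`. -/
theorem exists_factorization [DecidableEq A] {u v : FreeGroup A}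
    (hr : FreeGroup.IsReduced (u.toWord ++ v.toWord)) {r : InverseHull (SubshiftSemigroup X)}
    (h : degree r = ((u * v : FreeGroup A) : WithZero (FreeGroup A))) :
    ∃ s t : InverseHull (SubshiftSemigroup X), degree s = u ∧ degree t = v ∧ s * t = r := by
  have hr0 : r ≠ 0 := fun h0 => by
    rw [(vanishesOnlyAtZero_degree r).2 h0] at h
    exact WithZero.coe_ne_zero h.symm
  have hsplit : ∀ x y, y ∈ r.val x → _ := fun x y hxy =>
    FreeGroup.positive_or_negative_of_isReduced (toWord_mem x).1 (getLast?_toWord_eq hxy) hr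
      ((degree_eq_coe_iff hxy).1 h)
  have hinv : ∀ s, degree s⁻¹ = (degree s)⁻¹ :=
    map_inv_of_isPartialHom (vanishesOnlyAtZero_degree (X := X)) isPartialHom_degree
  obtain ⟨x, y, hxy⟩ := InverseHull.ne_zero_iff.1 hr0
  rcases hsplit x y hxy with ⟨m, -, -, hu, -⟩ | ⟨m, -, -, hv, -⟩
  · obtain ⟨s, hs, hsr⟩ := exists_left_factor hr0 m fun x y hxy => by
      rcases hsplit x y hxy with ⟨m', z, hz, hu', hy⟩ | ⟨m', z, hz, hv, hx⟩
      · exact ⟨z, hz, by rw [hy, FreeGroup.prod_map_of_injective (hu.symm.trans hu')]⟩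
      · refine ⟨z, hz, FreeGroup.prod_map_of_injective ?_⟩
        -- Here `x = v⁻¹ z`, so `y = u v x = u z` in the free group, and both sides are positive
        -- words.
        have h1 := (degree_eq_coe_iff hxy).1 h
        rw [toFreeGroup, toFreeGroup, hx] at h1
        simp only [List.map_append, List.prod_append] at h1 ⊢
        rw [h1, ← hv, ← hu]
        group
    refine ⟨s, s⁻¹ * r, by rw [hs, hu], ?_, hsr⟩
    have h1 := isPartialHom_degree s (s⁻¹ * r) (by rwa [hsr])
    rw [hsr, h, hs, hu, WithZero.coe_mul] at h1
    exact (mul_left_cancel₀ WithZero.coe_ne_zero h1).symm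
  -- The mirror case: `v⁻¹` is a positive left factor of the degree of `r⁻¹`, so it is split off
  -- there and the result is inverted.
  · have hi0 : r⁻¹ ≠ 0 := fun h0 => hr0 <| by
      rw [← inv_inv' r, h0, inv_eq_self_of_idem (mul_zero 0)]
    obtain ⟨s, hs, hsr⟩ := exists_left_factor hi0 m fun y x hxy => by
      rw [InverseHull.mem_inv] at hxy
      rcases hsplit x y hxy with ⟨m', z, hz, hu, hy⟩ | ⟨m', z, hz, hv', hx⟩
      · refine ⟨z, hz, FreeGroup.prod_map_of_injective ?_⟩
        have h1 := (degree_eq_coe_iff hxy).1 h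
        rw [toFreeGroup, toFreeGroup, hy] at h1
        simp only [List.map_append, List.prod_append] at h1 ⊢
        rw [← hu, mul_assoc, mul_right_inj] at h1
        rw [h1, ← hv, inv_mul_cancel_left]
      · exact ⟨z, hz, by rw [hx, FreeGroup.prod_map_of_injective (hv.symm.trans hv')]⟩
    have hrs : r * s * s⁻¹ = r := by
      have h1 := congrArg (·⁻¹) hsr
      simp only [mul_inv_rev', inv_inv'] at h1
      exact h1
    have hv' : degree s⁻¹ = v := by
      rw [hinv, hs, ← hv, WithZero.coe_inv, inv_inv]
    refine ⟨r * s, s⁻¹, ?_, hv', hrs⟩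
    have h1 := isPartialHom_degree (r * s) s⁻¹ (by rwa [hrs])
    rw [hrs, h, hv', WithZero.coe_mul] at h1
    exact (mul_right_cancel₀ WithZero.coe_ne_zero h1).symm

theorem toWord_eq_cons_of_degree_eq_of [DecidableEq A] {f : InverseHull (SubshiftSemigroup X)}
    {a : A} (hf : degree f = FreeGroup.of a) {x y : {x : SubshiftSemigroup X // x ≠ 0}}
    (h : y ∈ f.val x) : toWord y = a :: toWord x := by
  refine FreeGroup.prod_map_of_injective ?_
  simp only [List.map_cons, List.prod_cons]
  exact (degree_eq_coe_iff h).1 hf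

/-- A word in both ranges would begin with `a` and with `b`. -/
theorem mul_inv_self_mul_mul_inv_self_eq_zero [DecidableEq A]
    {s t : InverseHull (SubshiftSemigroup X)} {a b : A} (hab : a ≠ b)
    (hs : degree s = FreeGroup.of a) (ht : degree t = FreeGroup.of b) :
    (s * s⁻¹) * (t * t⁻¹) = 0 := by
  by_contra h
  obtain ⟨x, y, h⟩ := InverseHull.ne_zero_iff.1 h
  obtain ⟨z, h1, h2⟩ := InverseHull.mem_mul.1 h
  obtain ⟨v, -, h1⟩ := InverseHull.mem_mul.1 h1
  obtain ⟨w, h2, -⟩ := InverseHull.mem_mul.1 h2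
  have h3 := toWord_eq_cons_of_degree_eq_of ht h1
  rw [toWord_eq_cons_of_degree_eq_of hs (InverseHull.mem_inv.1 h2)] at h3
  exact hab (List.cons.inj h3).1

end SubshiftSemigroup

end Subshift

open InverseSemigroupWithZero in
theorem mainTheorem11 {A : Type*} [Finite A] [DecidableEq A] [TopologicalSpace A]
    [DiscreteTopology A] (X : Subshift A ℕ) :
    IsStronglyZeroEUnitary (InverseHull (SubshiftSemigroup X)) ∧
    ∃ d : InverseHull (SubshiftSemigroup X) → WithZero (FreeGroup A),
      VanishesOnlyAtZero d ∧ IsIdempotentPure d ∧ IsPartialHom d ∧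
      (∀ μ : SubshiftSemigroup X, d (hullTheta μ) = μ.toFreeGroupWithZero) ∧
      ((∀ a : A, [a] ∈ subshiftLanguage X) →
        ∃ e : UniversalGroup (InverseHull (SubshiftSemigroup X)) ≃* FreeGroup A,
          ∀ s, d s = WithZero.map' e.toMonoidHom (universalMap _ s)) ∧
      ∃ α : TopPartialAction (FreeGroup A) (Spectrum (InverseHull (SubshiftSemigroup X))),
        α.IsInducedBy d ∧ α.IsSemiSaturated ∧ α.IsOrthogonal := by
  have h0 := SubshiftSemigroup.vanishesOnlyAtZero_degree (X := X)
  have hi := SubshiftSemigroup.isIdempotentPure_degree (X := X)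
  have hm := SubshiftSemigroup.isPartialHom_degree (X := X)
  have hα := isInducedBy_spectralPartialAction h0 hi hm
  refine ⟨⟨FreeGroup A, inferInstance, SubshiftSemigroup.degree, h0, hi, hm⟩,
    SubshiftSemigroup.degree, h0, hi, hm, SubshiftSemigroup.degree_hullTheta,
    SubshiftSemigroup.exists_universalGroup_equiv, spectralPartialAction h0 hi hm, hα,
    fun u v huv => ?_, fun a b hab => ?_⟩
  · exact trans_act_eq_of_exists_factorization hα fun _ =>
      SubshiftSemigroup.exists_factorization huv
  · exact disjoint_range_of_forall_mul_eq_zero hα fun _ _ =>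
      SubshiftSemigroup.mul_inv_self_mul_mul_inv_self_eq_zero hab
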